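/- Upper bound of the stability level. For $r\ge 3$ and $n>r$ with $nr$ even let $G_n$ be uniformly distributed on the simple $r$-regular graphs with vertex set $V_n=\{1,\dots,n\}$; let $d(x,y)$ be the graph distance, $d=\mathrm{diam}(G_n)$, and $i_e(G_n)=\min_{\emptyset\neq A\subset V_n,\,|A|\le n/2}|\partial_eA|/|A|$, where $\partial_e A$ is the set of edges between $A$ and its complement. Let the interaction be either $\mathcal J(i)=Jr^{1-i}$ or $\mathcal J(i)=Ji^{-\lambda}$ with $\lambda>2$, and for $\sigma\in\{-1,+1\}^{V_n}$ put $$H(\sigma)=-\sum_{\{x,y\}\subset V_n,\ x\ne y}\mathcal J(d(x,y))\,\sigma_x\sigma_y-h\sum_{x\in V_n}\sigma_x ,$$ every unordered pair being counted once. A path is a finite sequence of configurations in which each one arises from the preceding one by a single spin flip; $\Phi(\sigma,\eta)$ is the minimum over all paths from $\sigma$ to $\eta$ of the maximum of $H$ along the path, and the stability level of $\sigma$ is $$V_\sigma=\min_{\eta:\,H(\eta)<H(\sigma)}\Phi(\sigma,\eta)-H(\sigma)$$ ($V_\sigma=\infty$ if there is no such $\eta$). Let $$f=\begin{cases} r &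 \text{if } \mathcal J(i)=Jr^{1-i},\\ r-2 & \text{if } \mathcal J(i)=Ji^{-\lambda},\ \lambda\ge d,\\ \zeta(\lambda)(r-1)^d & \text{if } \mathcal J(i)=Ji^{-\lambda},\ \lambda<d,\end{cases}\qquad \zeta(\lambda)=\sum_{k\ge1}k^{-\lambda}.$$ Condition 1 for $(r,n,J,h,G_n)$ reads: $r\ge3$, $n>\max\{r^r,\lceil r^2J/h\rceil\}$, $h>0$ and $J\ge\max\{1,\lceil h/i_e(G_n)\rceil\}$ (in particular $i_e(G_n)>0$, so $G_n$ is connected). Claim. There is a function $\varepsilon:\mathbb N\to\mathbb R$ with $\varepsilon(r)=o(r)$ as $r\to\infty$, not depending on $n$, $J$, $h$, $\lambda$, the graph or the type of interaction, such that for every fixed $r\ge 3$, each of the two types of interaction and all parameters $J=J_n$, $h=h_n$ and (for the power law) $\lambda=\lambda_n>2$, constant or varying with $n$, the following holds with high probability, i.e. with probability tending to $1$ as $n\to\infty$ through the integers with $nr$ even: if Condition 1 is satisfied, then for all $\sigma\in\{-1,+1\}^{V_n}$ other than the all-plus configuration $\mathbf{+1}$, $$V_\sigma\le\Gamma_u:=J\,\bigl(r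 f+\varepsilon(r)\bigr)\,n .$$ -/

import Mathlib

open Filter Topology Asymptotics

noncomputable section

/-! ### Random regular graphs and the Cheeger constant -/

open Classical in
/-- The simple `r`-regular graphs on the vertex set `V_n`, modelled by `Fin n`. -/
def regularGraphs (n r : ℕ) : Set (SimpleGraph (Fin n)) :=
  {G | G.IsRegularOfDegree r}

/-- The probability of the event `E` when the graph is selected uniformly at random from the set
of all simple `r`-regular graphs with `n` vertices. -/
def randomRegularProb (n r : ℕ) (E : SimpleGraph (Fin n) → Prop) : ℝ :=
  ({G ∈ regularGraphs n r | E G}.ncard : ℝ) / ((regularGraphs n r).ncard : ℝ)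

/-- `E n` holds with high probability for the random `r`-regular graph with `n` vertices: its
probability tends to `1` as `n → ∞` through the integers with `n * r` even. -/
def WithHighProb (r : ℕ) (E : (n : ℕ) → SimpleGraph (Fin n) → Prop) : Prop :=
  Tendsto (fun n : ℕ => randomRegularProb n r (E n)) (atTop ⊓ 𝓟 {n : ℕ | Even (n * r)}) (𝓝 1)

open Classical in
/-- The Cheeger constant `min |∂_e A| / |A|` over nonempty `A` with `|A| ≤ n / 2`, where `∂_e A` is
the set of edges joining `A` to its complement. -/
def cheegerConstant {n : ℕ} (G : SimpleGraph (Fin n)) : ℝ :=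
  sInf {q : ℝ | ∃ A : Finset (Fin n), A.Nonempty ∧ 2 * A.card ≤ n ∧
    q = ((G.interedges A Aᶜ).card : ℝ) / (A.card : ℝ)}

/-! ### The long-range Ising model -/

/-- Spin configurations: `ℤˣ = {1, -1}`; the homogeneous state with all spins plus is `1`. -/
abbrev Config (n : ℕ) : Type := Fin n → ℤˣ

/-- The interaction `i ↦ J r^{1-i}`. -/
def expInteraction (r : ℕ) (J : ℝ) (i : ℕ) : ℝ := J * (r : ℝ) ^ (1 - (i : ℤ))

/-- The interaction `i ↦ J i^{-lam}`. -/
def powInteraction (J lam : ℝ) (i : ℕ) : ℝ := J * (i : ℝ) ^ (-lam)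

/-- The Hamiltonian with pair interaction `Jint` of the graph distance and external field `h`; every
unordered pair of distinct vertices is counted once. -/
def hamiltonian {n : ℕ} (G : SimpleGraph (Fin n)) (Jint : ℕ → ℝ) (h : ℝ) (σ : Config n) : ℝ :=
  - (∑ x : Fin n, ∑ y ∈ Finset.Ioi x,
      Jint (G.dist x y) * ((σ x : ℤ) : ℝ) * ((σ y : ℤ) : ℝ))
  - h * ∑ x : Fin n, ((σ x : ℤ) : ℝ)

/-! ### Communication height and stability level -/

/-- The configuration obtained from `σ` by flipping the spin at `x`. -/
def flipSpin {n : ℕ} (σ : Config n) (x : Fin n) : Config n := Function.update σ x (-σ x)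

theorem flipSpin_flipSpin {n : ℕ} (σ : Config n) (x : Fin n) :
    flipSpin (flipSpin σ x) x = σ := by
  simp [flipSpin]

theorem flipSpin_ne {n : ℕ} (σ : Config n) (x : Fin n) : flipSpin σ x ≠ σ := by
  intro hx
  have h1 : -σ x = σ x := by simpa [flipSpin] using congrFun hx x
  rcases Int.units_eq_one_or (σ x) with h2 | h2 <;> rw [h2] at h1 <;> revert h1 <;> decide

/-- The graph on configurations whose edges are the single spin flips; its walks are the paths
along which energy barriers are measured. -/
def flipGraph (n : ℕ) : SimpleGraph (Config n) where
  Adj σ η := ∃ x, η = flipSpin σ x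
  symm := ⟨fun σ η hs => by
    obtain ⟨x, rfl⟩ := hs
    exact ⟨x, (flipSpin_flipSpin σ x).symm⟩⟩
  loopless := ⟨fun σ hs => by
    obtain ⟨x, hx⟩ := hs
    exact flipSpin_ne σ x hx.symm⟩

/-- The communication height `Φ(σ, η)`, the least possible maximal energy along a path
from `σ` to `η`. -/
def commHeight {n : ℕ} (H : Config n → ℝ) (σ η : Config n) : EReal :=
  ⨅ w : (flipGraph n).Walk σ η, ⨆ ζ ∈ w.support, (H ζ : EReal)

/-- The communication height between a configuration and a set (`⊤` if the set is empty). -/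
def commHeightSet {n : ℕ} (H : Config n → ℝ) (σ : Config n) (S : Set (Config n)) : EReal :=
  ⨅ η ∈ S, commHeight H σ η

/-- The stability level `V_σ = Φ(σ, I_σ) - H(σ)` with `I_σ` the set of the configurations of energy
lower than that of `σ`; it is `⊤` if there are none. -/
def stabilityLevel {n : ℕ} (H : Config n → ℝ) (σ : Config n) : EReal :=
  commHeightSet H σ {η | H η < H σ} - (H σ : EReal)

/-! ### The standing condition and the bound -/

/-- The condition on the parameters other than `3 ≤ r`. Positivity of the Cheeger constant is what
makes the quotient `h / i_e(G)` finite. -/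
structure ParamCondition (r n : ℕ) (J h : ℝ) (G : SimpleGraph (Fin n)) : Prop where
  n_large : max (r ^ r) ⌈(r : ℝ) ^ 2 * J / h⌉₊ < n
  h_pos : 0 < h
  cheeger_pos : 0 < cheegerConstant G
  J_large : max 1 (⌈h / cheegerConstant G⌉ : ℝ) ≤ J

/-- The series `∑_{k ≥ 1} k^{-lam}`. -/
def zetaSum (lam : ℝ) : ℝ := ∑' k : ℕ, ((k : ℝ) + 1) ^ (-lam)

/-- The function `f` for the exponential interaction. -/
def fExp (r : ℕ) : ℝ := r

/-- The function `f` for the power-law interaction on a graph of diameter `d`. -/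
def fPow (r : ℕ) (lam : ℝ) (d : ℕ) : ℝ :=
  if (d : ℝ) ≤ lam then (r : ℝ) - 2 else zetaSum lam * ((r : ℝ) - 1) ^ d

/-- `J (r f + e) n`, where `e` is the value at `r` of an error term of order `o(r)`. -/
def gammaU (J : ℝ) (r : ℕ) (f e : ℝ) (n : ℕ) : ℝ := J * ((r : ℝ) * f + e) * (n : ℝ)

end

/-! The bound is deterministic. From any `σ ≠ 1`, turn the minus spins into plus one at a time. The
field energy never rises on the way, and each pair can cost at most twice its interaction, so the
barrier to the all-plus state, which has lower energy, is at most the interaction summed over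
ordered pairs: `n` times a bound `B` on the total interaction of one vertex
(`stabilityLevel_le_of_sum_le`).

To find `B`, count vertices by distance: a connected `r`-regular graph has at most `r (r - 1) ^ i`
vertices at distance `i + 1`. The exponential interaction then gives a geometric series with sum `J
r ^ 2`. For the power law below the diameter, every sphere factor is replaced by `(r - 1) ^ d`,
leaving a zeta series. For exponents at least the diameter, the vertices beyond the neighbours
contribute at most `J` once the diameter is large, and `r + 1 ≤ r (r - 2) + 1` for `r ≥ 3`. Hence `ε
= 1` suffices.

Randomness plays no role: the bound holds for every regular graph satisfying the condition once `n`
is large. -/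

/-! ### Energy along the increasing path -/

open Finset in
theorem two_mul_sum_Ioi_eq_sum_erase {n : ℕ} (a : Fin n → Fin n → ℝ) (hs : ∀ x y, a x y = a y x) :
    2 * ∑ x, ∑ y ∈ Ioi x, a x y = ∑ x, ∑ y ∈ univ.erase x, a x y := by
  have h1 : ∀ x, ∑ y ∈ Ioi x, a x y = ∑ y, if x < y then a x y else 0 := fun x => by
    rw [← sum_filter]; congr 1; ext; simp
  have h2 : ∑ x, ∑ y ∈ Ioi x, a x y = ∑ x, ∑ y, if y < x then a x y else 0 := by
    simp only [h1]
    rw [sum_comm]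
    exact sum_congr rfl fun x _ => sum_congr rfl fun y _ => by rw [hs]
  have h3 : ∀ x, ∑ y ∈ univ.erase x, a x y = ∑ y, if y ≠ x then a x y else 0 := fun x => by
    rw [← sum_filter]; congr 1; ext; simp
  rw [two_mul]
  nth_rewrite 1 [sum_congr rfl fun x _ => h1 x]
  rw [h2, ← sum_add_distrib, sum_congr rfl fun x _ => h3 x]
  refine sum_congr rfl fun x _ => ?_
  rw [← sum_add_distrib]
  refine sum_congr rfl fun y _ => ?_
  rcases lt_trichotomy x y with h | h | h
  · simp [h, h.ne', h.not_gt]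
  · simp [h]
  · simp [h, h.ne, h.not_gt]

theorem spin_mul_le_one (a b : ℤˣ) : ((a : ℤ) : ℝ) * ((b : ℤ) : ℝ) ≤ 1 := by
  rcases Int.units_eq_one_or a with rfl | rfl <;> rcases Int.units_eq_one_or b with rfl | rfl <;>
    norm_num

theorem neg_one_le_spin_mul (a b : ℤˣ) : -1 ≤ ((a : ℤ) : ℝ) * ((b : ℤ) : ℝ) := by
  rcases Int.units_eq_one_or a with rfl | rfl <;> rcases Int.units_eq_one_or b with rfl | rfl <;>
    norm_num

theorem spin_le_of_imp {a b : ℤˣ} (hab : a = 1 → b = 1) : ((a : ℤ) : ℝ) ≤ ((b : ℤ) : ℝ) := by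
  rcases Int.units_eq_one_or a with rfl | rfl
  · rw [hab rfl]
  · rcases Int.units_eq_one_or b with rfl | rfl <;> norm_num

open Finset in
/-- Turning minus spins into plus spins raises the energy by at most the total interaction over the
ordered pairs of distinct vertices. -/
theorem hamiltonian_le_add_sum_erase {n : ℕ} (G : SimpleGraph (Fin n)) {Jint : ℕ → ℝ}
    (hJ : ∀ i, 0 ≤ Jint i) {h : ℝ} (hh : 0 ≤ h) {σ ζ : Config n} (hσ : ∀ x, σ x = 1 → ζ x = 1) :
    hamiltonian G Jint h ζ ≤
      hamiltonian G Jint h σ + ∑ x, ∑ y ∈ univ.erase x, Jint (G.dist x y) := by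
  -- The factor 2 is the range of a pair term: its spin product can drop from 1 to -1.
  rw [← two_mul_sum_Ioi_eq_sum_erase _ fun x y => by rw [SimpleGraph.dist_comm]]
  have h1 : h * ∑ x, ((σ x : ℤ) : ℝ) ≤ h * ∑ x, ((ζ x : ℤ) : ℝ) :=
    mul_le_mul_of_nonneg_left (sum_le_sum fun x _ => spin_le_of_imp (hσ x)) hh
  have h2 : ∑ x, ∑ y ∈ Ioi x, Jint (G.dist x y) * ((σ x : ℤ) : ℝ) * ((σ y : ℤ) : ℝ) ≤
      ∑ x, ∑ y ∈ Ioi x, Jint (G.dist x y) :=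
    sum_le_sum fun x _ => sum_le_sum fun y _ => by
      rw [mul_assoc]; exact mul_le_of_le_one_right (hJ _) (spin_mul_le_one _ _)
  have h3 : -∑ x, ∑ y ∈ Ioi x, Jint (G.dist x y) ≤
      ∑ x, ∑ y ∈ Ioi x, Jint (G.dist x y) * ((ζ x : ℤ) : ℝ) * ((ζ y : ℤ) : ℝ) := by
    simp only [← sum_neg_distrib]
    refine sum_le_sum fun x _ => sum_le_sum fun y _ => ?_
    rw [mul_assoc]
    nlinarith [hJ (G.dist x y), neg_one_le_spin_mul (ζ x) (ζ y)]
  unfold hamiltonian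
  linarith

-- All-plus maximises every pair term because the interaction is nonnegative; strictness comes from
-- the field alone.
open Finset in
theorem hamiltonian_one_lt {n : ℕ} (G : SimpleGraph (Fin n)) {Jint : ℕ → ℝ}
    (hJ : ∀ i, 0 ≤ Jint i) {h : ℝ} (hh : 0 < h) {σ : Config n} (hσ : σ ≠ 1) :
    hamiltonian G Jint h 1 < hamiltonian G Jint h σ := by
  have h1 : h * ∑ x, ((σ x : ℤ) : ℝ) < h * ∑ x, (((1 : Config n) x : ℤ) : ℝ) := by
    obtain ⟨x, hx⟩ := Function.ne_iff.1 hσ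
    refine mul_lt_mul_of_pos_left (sum_lt_sum (fun y _ => spin_le_of_imp fun _ => rfl)
      ⟨x, mem_univ x, ?_⟩) hh
    rw [(Int.units_eq_one_or (σ x)).resolve_left hx]
    norm_num
  have h2 : ∑ x, ∑ y ∈ Ioi x, Jint (G.dist x y) * ((σ x : ℤ) : ℝ) * ((σ y : ℤ) : ℝ) ≤
      ∑ x, ∑ y ∈ Ioi x, Jint (G.dist x y) * (((1 : Config n) x : ℤ) : ℝ) *
        (((1 : Config n) y : ℤ) : ℝ) :=
    sum_le_sum fun x _ => sum_le_sum fun y _ => by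
      rw [mul_assoc, mul_assoc]
      exact mul_le_mul_of_nonneg_left ((spin_mul_le_one _ _).trans (by simp)) (hJ _)
  unfold hamiltonian
  linarith

/-- The homogeneous plus state is reached by turning the minus spins into plus spins one by one. -/
theorem exists_increasing_walk_to_one {n : ℕ} (σ : Config n) :
    ∃ w : (flipGraph n).Walk σ 1, ∀ ζ ∈ w.support, ∀ x, σ x = 1 → ζ x = 1 := by
  induction hk : (Finset.univ.filter fun x => σ x ≠ 1).card generalizing σ with
  | zero =>
    have h1 : σ = 1 := by
      funext x
      have := Finset.filter_eq_empty_iff.1 (Finset.card_eq_zero.1 hk) (Finset.mem_univ x)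
      simpa using this
    subst h1
    exact ⟨.nil, fun ζ hζ x _ => by simp_all⟩
  | succ k ih =>
    obtain ⟨x, hx⟩ := Finset.card_pos.1 (hk.trans_gt k.succ_pos)
    have hx1 : σ x ≠ 1 := (Finset.mem_filter.1 hx).2
    have hx2 : -σ x = 1 := by rw [(Int.units_eq_one_or (σ x)).resolve_left hx1]; simp
    have hset : (Finset.univ.filter fun y => flipSpin σ x y ≠ 1) =
        (Finset.univ.filter fun y => σ y ≠ 1).erase x := by
      ext y
      rw [Finset.mem_erase, Finset.mem_filter, Finset.mem_filter]
      by_cases hy : y = x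
      · subst hy; simp [flipSpin, hx2]
      · simp [flipSpin, hy]
    obtain ⟨w, hw⟩ := ih (flipSpin σ x) (by rw [hset, Finset.card_erase_of_mem hx, hk]; rfl)
    have hadj : (flipGraph n).Adj σ (flipSpin σ x) := ⟨x, rfl⟩
    refine ⟨.cons hadj w, fun ζ hζ y hy => ?_⟩
    rw [SimpleGraph.Walk.support_cons, List.mem_cons] at hζ
    rcases hζ with rfl | hζ
    · exact hy
    · refine hw ζ hζ y ?_
      have hyx : y ≠ x := by rintro rfl; exact hx1 hy
      simpa [flipSpin, hyx] using hy

/-- A uniform bound on the total interaction of a vertex bounds all stability levels. -/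
theorem stabilityLevel_le_of_sum_le {n : ℕ} (G : SimpleGraph (Fin n)) {Jint : ℕ → ℝ}
    (hJ : ∀ i, 0 ≤ Jint i) {h B : ℝ} (hh : 0 < h)
    (hB : ∀ x, ∑ y ∈ Finset.univ.erase x, Jint (G.dist x y) ≤ B) {σ : Config n} (hσ : σ ≠ 1) :
    stabilityLevel (hamiltonian G Jint h) σ ≤ ((B * n : ℝ) : EReal) := by
  obtain ⟨w, hw⟩ := exists_increasing_walk_to_one σ
  have hsum : ∑ x, ∑ y ∈ Finset.univ.erase x, Jint (G.dist x y) ≤ B * n :=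
    (Finset.sum_le_sum fun x _ => hB x).trans (by simp [mul_comm])
  have h1 : commHeightSet (hamiltonian G Jint h) σ
      {η | hamiltonian G Jint h η < hamiltonian G Jint h σ} ≤
      ((B * n + hamiltonian G Jint h σ : ℝ) : EReal) := by
    refine (iInf₂_le (1 : Config n) (hamiltonian_one_lt G hJ hh hσ)).trans ((iInf_le _ w).trans ?_)
    refine iSup₂_le fun ζ hζ => EReal.coe_le_coe_iff.2 ?_
    have := hamiltonian_le_add_sum_erase G hJ hh.le (hw ζ hζ)
    linarith
  unfold stabilityLevel
  refine (EReal.sub_le_sub h1 le_rfl).trans (le_of_eq ?_)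
  rw [← EReal.coe_sub]
  congr 1
  ring

/-! ### Spheres in regular graphs -/

/-- A connected component has no boundary edges, and neither has its complement. If the graph were
disconnected, the one with at most half of the vertices would force the Cheeger constant to be at
most 0. -/
theorem connected_of_cheegerConstant_pos {n : ℕ} (G : SimpleGraph (Fin n))
    (hn : 0 < n) (hG : 0 < cheegerConstant G) : G.Connected := by
  classical
  have : Nonempty (Fin n) := ⟨⟨0, hn⟩⟩
  refine ⟨fun u v => ?_⟩
  by_contra huv
  have key : ∀ A : Finset (Fin n), A.Nonempty → 2 * A.card ≤ n →
      (∀ a ∈ A, ∀ b ∉ A, ¬ G.Adj a b) → False := by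
    intro A hA hcard hsep
    refine hG.not_ge (csInf_le ⟨0, ?_⟩ ⟨A, hA, hcard, ?_⟩)
    · rintro q ⟨A, -, -, rfl⟩
      positivity
    · rw [Finset.card_eq_zero.2, Nat.cast_zero, zero_div]
      refine Finset.eq_empty_of_forall_notMem fun e he => ?_
      rw [SimpleGraph.mem_interedges_iff] at he
      exact hsep _ he.1 _ (Finset.mem_compl.1 he.2.1) he.2.2
  let A : Finset (Fin n) := Finset.univ.filter fun y => G.Reachable u y
  have hmem : ∀ y, y ∈ A ↔ G.Reachable u y := fun y => by simp [A]
  have hsep : ∀ a ∈ A, ∀ b ∉ A, ¬ G.Adj a b := fun a ha b hb hab =>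
    hb ((hmem b).2 (((hmem a).1 ha).trans hab.reachable))
  rcases le_total (2 * A.card) n with hle | hle
  · exact key A ⟨u, (hmem u).2 (SimpleGraph.Reachable.refl u)⟩ hle hsep
  · refine key Aᶜ ⟨v, Finset.mem_compl.2 fun hv => huv ((hmem v).1 hv)⟩ ?_ ?_
    · rw [Finset.card_compl, Fintype.card_fin]
      omega
    · intro a ha b hb hab
      exact hsep b (by simpa using hb) a (Finset.mem_compl.1 ha) hab.symm

theorem SimpleGraph.Connected.exists_adj_dist_eq {V : Type*} {G : SimpleGraph V}
    (hG : G.Connected) {x z : V} {i : ℕ} (hz : G.dist x z = i + 1) :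
    ∃ y, G.Adj z y ∧ G.dist x y = i := by
  obtain ⟨p, hp⟩ := hG.exists_walk_length_eq_dist z x
  rw [G.dist_comm, hz] at hp
  cases p with
  | nil => simp at hp
  | cons hadj q =>
    rename_i y
    refine ⟨y, hadj, ?_⟩
    have h1 := G.dist_le q
    rw [G.dist_comm] at h1
    have h2 := hG.dist_triangle (u := x) (v := y) (w := z)
    rw [G.dist_comm (u := y), SimpleGraph.dist_eq_one_iff_adj.2 hadj] at h2
    rw [SimpleGraph.Walk.length_cons] at hp
    omega

/-- The sphere of radius `i + 1` in a connected `r`-regular graph has at most `r (r - 1) ^ i`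
vertices. -/
theorem SimpleGraph.Connected.card_sphere_le {V : Type*} [Fintype V] {G : SimpleGraph V}
    [G.LocallyFinite] {r : ℕ} (hG : G.Connected) (hr : G.IsRegularOfDegree r) (x : V) (i : ℕ) :
    (Finset.univ.filter fun y => G.dist x y = i + 1).card ≤ r * (r - 1) ^ i := by
  classical
  induction i with
  | zero =>
    rw [pow_zero, mul_one, ← hr x, ← G.card_neighborFinset_eq_degree]
    refine Finset.card_le_card fun y hy => ?_
    simpa [SimpleGraph.dist_eq_one_iff_adj] using hy
  | succ i ih =>
    set S := Finset.univ.filter fun y => G.dist x y = i + 1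
    have hsub : (Finset.univ.filter fun y => G.dist x y = i + 1 + 1) ⊆
        S.biUnion fun y => (G.neighborFinset y).filter fun z => G.dist x z = i + 1 + 1 := by
      intro z hz
      have hz' := (Finset.mem_filter.1 hz).2
      obtain ⟨y, hy, hxy⟩ := hG.exists_adj_dist_eq hz'
      simp only [Finset.mem_biUnion, Finset.mem_filter, SimpleGraph.mem_neighborFinset]
      exact ⟨y, by simp [S, hxy], hy.symm, hz'⟩
    refine (Finset.card_le_card hsub).trans
      ((Finset.card_biUnion_le_card_mul _ _ (r - 1) fun y hy => ?_).trans ?_)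
    -- A vertex `y` of the previous sphere has a neighbour one step closer to `x`, which leaves at
    -- most `r - 1` neighbours further out.
    · obtain ⟨w, hw, hxw⟩ := hG.exists_adj_dist_eq (Finset.mem_filter.1 hy).2
      have hw' : w ∈ G.neighborFinset y := by simpa using hw
      rw [← hr y, ← G.card_neighborFinset_eq_degree, ← Finset.card_erase_of_mem hw']
      refine Finset.card_le_card fun z hz => ?_
      rw [Finset.mem_filter] at hz
      refine Finset.mem_erase.2 ⟨?_, hz.1⟩
      rintro rfl
      omega
    · calc S.card * (r - 1) ≤ r * (r - 1) ^ i * (r - 1) := Nat.mul_le_mul_right _ ih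
        _ = r * (r - 1) ^ (i + 1) := by ring

theorem SimpleGraph.Connected.dist_le_diam_of_finite {V : Type*} [Finite V] {G : SimpleGraph V}
    (hG : G.Connected) (x y : V) : G.dist x y ≤ G.diam := by
  have := hG.nonempty
  exact SimpleGraph.dist_le_diam (SimpleGraph.connected_iff_ediam_ne_top.1 hG)

theorem SimpleGraph.Connected.sum_dist_le {V : Type*} [Fintype V] [DecidableEq V]
    {G : SimpleGraph V} [G.LocallyFinite] {r : ℕ} (hG : G.Connected) (hr : G.IsRegularOfDegree r) (hr1 : 1 ≤ r) {g : ℕ → ℝ} (hg : ∀ i, 0 ≤ g i)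
    (x : V) :
    ∑ y ∈ Finset.univ.erase x, g (G.dist x y) ≤
      ∑ i ∈ Finset.range G.diam, (r : ℝ) * ((r : ℝ) - 1) ^ i * g (i + 1) := by
  -- Spheres are indexed by distance minus one; removing `x` makes every distance positive, so the
  -- truncated subtraction is exact.
  have hmaps : ∀ y ∈ Finset.univ.erase x, G.dist x y - 1 ∈ Finset.range G.diam := by
    intro y hy
    have h1 := hG.dist_le_diam_of_finite x y
    have h2 := hG.pos_dist_of_ne (Finset.ne_of_mem_erase hy).symm
    rw [Finset.mem_range]
    omega
  rw [← Finset.sum_fiberwise_of_maps_to hmaps]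
  refine Finset.sum_le_sum fun i _ => ?_
  have hval : ∀ y ∈ (Finset.univ.erase x).filter fun y => G.dist x y - 1 = i,
      G.dist x y = i + 1 := by
    intro y hy
    rw [Finset.mem_filter] at hy
    have := hG.pos_dist_of_ne (Finset.ne_of_mem_erase hy.1).symm
    omega
  rw [Finset.sum_congr rfl fun y hy => by rw [hval y hy], Finset.sum_const, nsmul_eq_mul]
  refine mul_le_mul_of_nonneg_right ?_ (hg _)
  have hcard : ((Finset.univ.erase x).filter fun y => G.dist x y - 1 = i).card ≤
      r * (r - 1) ^ i :=
    (Finset.card_le_card fun y hy => Finset.mem_filter.2 ⟨Finset.mem_univ y, hval y hy⟩).trans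
      (hG.card_sphere_le hr x i)
  calc _ ≤ ((r * (r - 1) ^ i : ℕ) : ℝ) := by exact_mod_cast hcard
    _ = _ := by push_cast [Nat.cast_sub hr1]; ring

/-- A connected `r`-regular graph with many vertices has large diameter. -/
theorem SimpleGraph.Connected.card_le_of_diam_le {V : Type*} [Fintype V] {G : SimpleGraph V}
    [G.LocallyFinite] {r D : ℕ} (hG : G.Connected) (hr : G.IsRegularOfDegree r) (hr1 : 1 ≤ r)
    (hD : G.diam ≤ D) :
    (Fintype.card V : ℝ) ≤ 1 + ∑ i ∈ Finset.range D, (r : ℝ) * ((r : ℝ) - 1) ^ i := by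
  classical
  obtain ⟨x⟩ := hG.nonempty
  have hr' : (0 : ℝ) ≤ (r : ℝ) - 1 := sub_nonneg.2 (by exact_mod_cast hr1)
  -- With constant weight 1 the interaction bound counts the vertices other than `x`.
  have h1 := hG.sum_dist_le hr hr1 (g := fun _ => 1)
    (fun _ => zero_le_one) x
  have h2 : (((Finset.univ : Finset V).erase x).card : ℝ) + 1 = Fintype.card V := by
    exact_mod_cast Finset.card_erase_add_one (Finset.mem_univ x)
  simp only [Finset.sum_const, nsmul_eq_mul, mul_one] at h1
  have h3 : ∑ i ∈ Finset.range G.diam, (r : ℝ) * ((r : ℝ) - 1) ^ i ≤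
      ∑ i ∈ Finset.range D, (r : ℝ) * ((r : ℝ) - 1) ^ i :=
    Finset.sum_le_sum_of_subset_of_nonneg (Finset.range_mono hD) fun i _ _ => by positivity
  linarith

/-! ### Total interaction of a vertex -/

/-- Sphere growth against decay leaves the ratio `(r - 1) / r`, whose full geometric series sums to
`r`. -/
theorem sum_expInteraction_le {r : ℕ} (hr : 1 ≤ r) {J : ℝ} (hJ : 0 ≤ J) (D : ℕ) :
    ∑ i ∈ Finset.range D, (r : ℝ) * ((r : ℝ) - 1) ^ i * expInteraction r J (i + 1) ≤
      J * ((r : ℝ) * r) := by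
  have hr0 : (0 : ℝ) < r := by exact_mod_cast hr
  have hr1 : (0 : ℝ) ≤ (r : ℝ) - 1 := sub_nonneg.2 (by exact_mod_cast hr)
  have h1 : ∀ i : ℕ, (r : ℝ) * ((r : ℝ) - 1) ^ i * expInteraction r J (i + 1) =
      J * r * (((r : ℝ) - 1) / r) ^ i := by
    intro i
    have : (1 : ℤ) - ((i + 1 : ℕ) : ℤ) = -(i : ℤ) := by push_cast; ring
    rw [expInteraction, this, zpow_neg, zpow_natCast, div_pow]
    field_simp
  have hq0 : 0 ≤ ((r : ℝ) - 1) / r := by positivity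
  have hq1 : ((r : ℝ) - 1) / r < 1 := by rw [div_lt_one hr0]; linarith
  have h2 := (summable_geometric_of_lt_one hq0 hq1).sum_le_tsum (Finset.range D)
    fun i _ => by positivity
  rw [tsum_geometric_of_lt_one hq0 hq1] at h2
  have h3 : (1 - ((r : ℝ) - 1) / r)⁻¹ = r := by
    rw [inv_eq_iff_eq_inv]; field_simp; ring
  rw [Finset.sum_congr rfl fun i _ => h1 i, ← Finset.mul_sum, ← mul_assoc]
  exact mul_le_mul_of_nonneg_left (h2.trans h3.le) (by positivity)

theorem sum_powInteraction_le_zetaSum {r : ℕ} (hr : 2 ≤ r) {J lam : ℝ} (hJ : 0 ≤ J)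
    (hlam : 1 < lam) (D : ℕ) :
    ∑ i ∈ Finset.range D, (r : ℝ) * ((r : ℝ) - 1) ^ i * powInteraction J lam (i + 1) ≤
      J * ((r : ℝ) * (zetaSum lam * ((r : ℝ) - 1) ^ D)) := by
  have hr1 : (1 : ℝ) ≤ (r : ℝ) - 1 := by
    have : (2 : ℝ) ≤ r := by exact_mod_cast hr
    linarith
  have hsummable : Summable fun k : ℕ => ((k : ℝ) + 1) ^ (-lam) := by
    have := (summable_nat_add_iff 1).2 (Real.summable_nat_rpow.2 (show -lam < -1 by linarith))
    simpa using this
  have h1 : ∑ i ∈ Finset.range D, ((i : ℝ) + 1) ^ (-lam) ≤ zetaSum lam :=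
    hsummable.sum_le_tsum _ fun i _ => by positivity
  calc _ ≤ ∑ i ∈ Finset.range D, J * r * ((r : ℝ) - 1) ^ D * ((i : ℝ) + 1) ^ (-lam) := by
        refine Finset.sum_le_sum fun i hi => ?_
        have h2 : ((r : ℝ) - 1) ^ i ≤ ((r : ℝ) - 1) ^ D :=
          pow_le_pow_right₀ hr1 (Finset.mem_range.1 hi).le
        rw [powInteraction]
        push_cast
        calc _ = J * r * ((i : ℝ) + 1) ^ (-lam) * ((r : ℝ) - 1) ^ i := by ring
          _ ≤ J * r * ((i : ℝ) + 1) ^ (-lam) * ((r : ℝ) - 1) ^ D :=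
            mul_le_mul_of_nonneg_left h2 (by positivity)
          _ = _ := by ring
    _ = J * r * ((r : ℝ) - 1) ^ D * ∑ i ∈ Finset.range D, ((i : ℝ) + 1) ^ (-lam) := by
        rw [Finset.mul_sum]
    _ ≤ J * r * ((r : ℝ) - 1) ^ D * zetaSum lam :=
        mul_le_mul_of_nonneg_left h1 (by positivity)
    _ = _ := by ring

/-- Gives `a ^ i / i ^ D ≤ a ^ (2 * a) / 2 ^ D` uniformly in `i`. Up to `2 * a` the numerator is
bounded by a constant; beyond it, `a ^ i ≤ a ^ D` and `i` exceeds `2 * a`. -/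
theorem pow_mul_two_pow_le {a i D : ℕ} (ha : 1 ≤ a) (hi : 2 ≤ i) (hiD : i ≤ D) :
    a ^ i * 2 ^ D ≤ a ^ (2 * a) * i ^ D := by
  rcases le_total i (2 * a) with h | h
  · exact Nat.mul_le_mul (Nat.pow_le_pow_right ha h) (Nat.pow_le_pow_left hi D)
  · calc a ^ i * 2 ^ D ≤ a ^ D * 2 ^ D := Nat.mul_le_mul_right _ (Nat.pow_le_pow_right ha hiD)
      _ = (2 * a) ^ D := by rw [mul_pow, mul_comm]
      _ ≤ i ^ D := Nat.pow_le_pow_left h D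
      _ ≤ a ^ (2 * a) * i ^ D := Nat.le_mul_of_pos_left _ (by positivity)

/-- If the exponent is at least the diameter and the diameter is large, then the neighbours of a
vertex carry almost all of its interaction. -/
theorem sum_powInteraction_le_of_le {r : ℕ} (hr : 2 ≤ r) {J lam : ℝ} (hJ : 0 ≤ J) {D : ℕ}
    (hlam : (D : ℝ) ≤ lam)
    (hD : (r : ℝ) * ((r : ℝ) - 1) ^ (2 * (r - 1)) * (D * (1 / 2 : ℝ) ^ D) ≤ 1) :
    ∑ i ∈ Finset.range D, (r : ℝ) * ((r : ℝ) - 1) ^ i * powInteraction J lam (i + 1) ≤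
      J * ((r : ℝ) + 1) := by
  have hr1 : (1 : ℝ) ≤ (r : ℝ) - 1 := by
    have : (2 : ℝ) ≤ r := by exact_mod_cast hr
    linarith
  rcases D with _ | D
  · simp; positivity
  have hterm : ∀ i ∈ Finset.range D,
      (r : ℝ) * ((r : ℝ) - 1) ^ (i + 1) * powInteraction J lam (i + 1 + 1) ≤
        J * ((r : ℝ) * ((r : ℝ) - 1) ^ (2 * (r - 1)) * (1 / 2 : ℝ) ^ (D + 1)) := by
    intro i hi
    have hiD : i + 2 ≤ D + 1 := by have := Finset.mem_range.1 hi; omega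
    have h1 : (((i + 1 + 1 : ℕ) : ℝ)) ^ (-lam) ≤ ((((i + 2 : ℕ) : ℝ)) ^ (D + 1))⁻¹ := by
      rw [← Real.rpow_natCast, ← Real.rpow_neg (by positivity)]
      exact Real.rpow_le_rpow_of_exponent_le (by push_cast; linarith [(i.cast_nonneg : (0:ℝ) ≤ i)])
        (neg_le_neg hlam)
    have h2 : ((r : ℝ) - 1) ^ (i + 2) * 2 ^ (D + 1) ≤
        ((r : ℝ) - 1) ^ (2 * (r - 1)) * ((i + 2 : ℕ) : ℝ) ^ (D + 1) := by
      have := pow_mul_two_pow_le (a := r - 1) (by omega) (by omega : 2 ≤ i + 2) hiD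
      have h3 : ((r - 1 : ℕ) : ℝ) = (r : ℝ) - 1 := by push_cast [Nat.cast_sub (by omega : 1 ≤ r)]; rfl
      rw [← h3]
      exact_mod_cast this
    -- One power of `r - 1` is given away so that the exponent matches the distance `i + 2` in `h2`.
    have h4 : ((r : ℝ) - 1) ^ (i + 1) ≤ ((r : ℝ) - 1) ^ (i + 2) :=
      pow_le_pow_right₀ hr1 (by omega)
    have h5 : ((r : ℝ) - 1) ^ (i + 1) * (((i + 1 + 1 : ℕ) : ℝ)) ^ (-lam) ≤
        ((r : ℝ) - 1) ^ (2 * (r - 1)) * (1 / 2 : ℝ) ^ (D + 1) := by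
      calc _ ≤ ((r : ℝ) - 1) ^ (i + 2) * ((((i + 2 : ℕ) : ℝ)) ^ (D + 1))⁻¹ :=
            mul_le_mul h4 h1 (by positivity) (by positivity)
        _ ≤ _ := by
          rw [← div_eq_mul_inv, div_le_iff₀ (by positivity), one_div, inv_pow, mul_right_comm,
            ← div_eq_mul_inv, le_div_iff₀ (by positivity)]
          exact h2
    rw [powInteraction]
    calc _ = J * r * (((r : ℝ) - 1) ^ (i + 1) * (((i + 1 + 1 : ℕ) : ℝ)) ^ (-lam)) := by ring
      _ ≤ J * r * (((r : ℝ) - 1) ^ (2 * (r - 1)) * (1 / 2 : ℝ) ^ (D + 1)) :=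
        mul_le_mul_of_nonneg_left h5 (by positivity)
      _ = _ := by ring
  -- The first term, from the neighbours, is exactly `J * r`; the `D` others share one bound.
  rw [Finset.sum_range_succ']
  have h6 := Finset.sum_le_sum hterm
  rw [Finset.sum_const, Finset.card_range, nsmul_eq_mul] at h6
  have h7 : (r : ℝ) * ((r : ℝ) - 1) ^ 0 * powInteraction J lam (0 + 1) = J * r := by
    simp [powInteraction, mul_comm]
  have h8 : (D : ℝ) * (J * ((r : ℝ) * ((r : ℝ) - 1) ^ (2 * (r - 1)) * (1 / 2 : ℝ) ^ (D + 1))) ≤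
      J * 1 := by
    refine le_trans ?_ (mul_le_mul_of_nonneg_left hD hJ)
    calc _ = J * ((r : ℝ) * ((r : ℝ) - 1) ^ (2 * (r - 1)) * (D * (1 / 2 : ℝ) ^ (D + 1))) := by ring
      _ ≤ _ := by
        refine mul_le_mul_of_nonneg_left (mul_le_mul_of_nonneg_left
          (mul_le_mul_of_nonneg_right ?_ (by positivity)) (by positivity)) hJ
        exact_mod_cast D.le_succ
  rw [h7]
  linarith

/-! ### Existence of regular graphs -/

open Classical in
theorem regular_of_symmetric_connection_set {V : Type*} [AddCommGroup V] [Fintype V] (S : Finset V)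
    (h0 : (0 : V) ∉ S) (hS : ∀ t ∈ S, -t ∈ S) :
    (SimpleGraph.circulantGraph (S : Set V)).IsRegularOfDegree S.card := by
  intro u
  rw [← SimpleGraph.card_neighborFinset_eq_degree,
    ← Finset.card_image_of_injective S (add_right_injective u)]
  congr 1
  ext v
  rw [SimpleGraph.mem_neighborFinset, SimpleGraph.circulantGraph, SimpleGraph.fromRel_adj,
    Finset.mem_image]
  simp only [Finset.mem_coe]
  constructor
  · rintro ⟨-, h | h⟩
    · exact ⟨v - u, by simpa using hS _ h, by abel⟩
    · exact ⟨v - u, h, by abel⟩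
  · rintro ⟨t, ht, rfl⟩
    refine ⟨fun h => h0 ?_, Or.inr (by simpa using ht)⟩
    rw [left_eq_add] at h
    rwa [h] at ht

/-- Needed because the probability is a quotient by the number of regular graphs. The witness is a
circulant graph: steps up to `r / 2` in both directions and, for odd `r`, the antipodal step `n /
2`, available since `n` is then even. -/
theorem regularGraphs_nonempty {n r : ℕ} (hrn : r < n) (hnr : Even (n * r)) :
    (regularGraphs n r).Nonempty := by
  classical
  have : NeZero n := ⟨by omega⟩
  let S : Finset (Fin n) := Finset.univ.filter fun t =>
    (1 ≤ t.val ∧ t.val ≤ r / 2) ∨ n - r / 2 ≤ t.val ∨ (r % 2 = 1 ∧ 2 * t.val = n)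
  have hcard : S.card = r := by
    let T : Finset ℕ := Finset.Icc 1 (r / 2) ∪ Finset.Ico (n - r / 2) n ∪
      (if r % 2 = 1 then {n / 2} else ∅)
    have hn2 : r % 2 = 1 → n % 2 = 0 := by
      intro h
      rcases Nat.even_mul.1 hnr with h' | h'
      · exact Nat.even_iff.1 h'
      · have := Nat.even_iff.1 h'; omega
    have hT : S.map Fin.valEmbedding = T := by
      ext t
      simp only [S, T, Finset.mem_map, Finset.mem_filter, Finset.mem_univ, true_and,
        Fin.valEmbedding_apply, Finset.mem_union, Finset.mem_Icc, Finset.mem_Ico]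
      constructor
      · rintro ⟨t, ht, rfl⟩
        have := t.isLt
        split_ifs with h <;> simp only [Finset.mem_singleton, Finset.notMem_empty, or_false] <;> omega
      · intro ht
        have hlt : t < n := by
          split_ifs at ht with h <;>
            simp only [Finset.mem_singleton, Finset.notMem_empty, or_false] at ht <;> omega
        refine ⟨⟨t, hlt⟩, ?_, rfl⟩
        split_ifs at ht with h <;>
          simp only [Finset.mem_singleton, Finset.notMem_empty, or_false] at ht
        · have := hn2 h
          simp only
          omega
        · simp only
          omega
    rw [← Finset.card_map Fin.valEmbedding, hT, Finset.card_union_of_disjoint,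
      Finset.card_union_of_disjoint, Nat.card_Icc, Nat.card_Ico]
    · split_ifs with h <;> simp <;> omega
    · rw [Finset.disjoint_left]
      intro t h1 h2
      rw [Finset.mem_Icc] at h1
      rw [Finset.mem_Ico] at h2
      omega
    · rw [Finset.disjoint_left]
      intro t h1 h2
      rw [Finset.mem_union, Finset.mem_Icc, Finset.mem_Ico] at h1
      split_ifs at h2 with h <;> simp only [Finset.mem_singleton, Finset.notMem_empty] at h2
      have := hn2 h
      omega
  have h0 : (0 : Fin n) ∉ S := by
    simp [S]
    omega
  have hneg : ∀ t ∈ S, -t ∈ S := by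
    intro t ht
    have ht0 : t ≠ 0 := fun h => h0 (h ▸ ht)
    have hval : (-t).val = n - t.val := by
      rw [Fin.val_neg, if_neg ht0]
    have hpos : t.val ≠ 0 := fun h => ht0 (Fin.ext (by simpa using h))
    have hlt := t.isLt
    simp only [S, Finset.mem_filter, Finset.mem_univ, true_and] at ht ⊢
    rw [hval]
    omega
  refine ⟨SimpleGraph.circulantGraph (S : Set (Fin n)), ?_⟩
  have := regular_of_symmetric_connection_set S h0 hneg
  rw [hcard] at this
  intro u
  convert this u

/-! ### From all large graphs to high probability -/

/-- A property of all large regular graphs holds with high probability. -/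
theorem withHighProb_of_eventually {r : ℕ} {E : (n : ℕ) → SimpleGraph (Fin n) → Prop}
    (hE : ∀ᶠ n in atTop, ∀ G ∈ regularGraphs n r, E n G) : WithHighProb r E := by
  refine tendsto_const_nhds.congr' ?_
  rw [EventuallyEq, eventually_inf_principal]
  filter_upwards [hE, eventually_gt_atTop r] with n hn hrn hnr
  have hset : {G ∈ regularGraphs n r | E n G} = regularGraphs n r :=
    Set.sep_eq_self_iff_mem_true.2 fun G hG => hn G hG
  have hpos : (regularGraphs n r).ncard ≠ 0 :=
    ((Set.ncard_pos (Set.toFinite _)).2 (regularGraphs_nonempty hrn hnr)).ne'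
  rw [randomRegularProb, hset, div_self (by exact_mod_cast hpos)]

theorem ParamCondition.one_le_J {r n : ℕ} {J h : ℝ} {G : SimpleGraph (Fin n)}
    (hP : ParamCondition r n J h G) : 1 ≤ J :=
  (le_max_left _ _).trans hP.J_large

theorem ParamCondition.connected {r n : ℕ} {J h : ℝ} {G : SimpleGraph (Fin n)}
    (hP : ParamCondition r n J h G) : G.Connected :=
  connected_of_cheegerConstant_pos G (pos_of_gt hP.n_large) hP.cheeger_pos

theorem mainTheorem2 :
    ∃ ε : ℕ → ℝ, (ε =o[atTop] fun r : ℕ => (r : ℝ)) ∧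
      ∀ r : ℕ, 3 ≤ r → ∀ J h : ℕ → ℝ,
        WithHighProb r (fun n G => ParamCondition r n (J n) (h n) G →
          ∀ σ : Config n, σ ≠ 1 →
            stabilityLevel (hamiltonian G (expInteraction r (J n)) (h n)) σ ≤
              ((gammaU (J n) r (fExp r) (ε r) n : ℝ) : EReal)) ∧
        ∀ lam : ℕ → ℝ, (∀ n, 2 < lam n) →
          WithHighProb r (fun n G => ParamCondition r n (J n) (h n) G →
            ∀ σ : Config n, σ ≠ 1 →
              stabilityLevel (hamiltonian G (powInteraction (J n) (lam n)) (h n)) σ ≤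
                ((gammaU (J n) r (fPow r (lam n) G.diam) (ε r) n : ℝ) : EReal)) := by
  classical
  refine ⟨fun _ => 1, ?_, fun r hr J h => ⟨?_, fun lam hlam => ?_⟩⟩
  · exact isLittleO_const_left.2 (Or.inr
      (tendsto_norm_atTop_atTop.comp tendsto_natCast_atTop_atTop))
  · refine withHighProb_of_eventually (Eventually.of_forall fun n G hG hP σ hσ => ?_)
    have hJ : 0 ≤ J n := zero_le_one.trans hP.one_le_J
    have hnn : ∀ i, 0 ≤ expInteraction r (J n) i := fun i => by
      rw [expInteraction]; positivity
    refine (stabilityLevel_le_of_sum_le G hnn hP.h_pos (B := J n * ((r : ℝ) * r))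
      (fun x => ?_) hσ).trans (EReal.coe_le_coe_iff.2 ?_)
    · have := hP.connected.sum_dist_le hG (by omega) hnn x
      exact this.trans (sum_expInteraction_le (by omega) hJ _)
    · rw [gammaU, fExp]
      gcongr
      linarith
  · obtain ⟨D₀, hD₀⟩ : ∃ D₀ : ℕ, ∀ D : ℕ, D₀ ≤ D →
        (r : ℝ) * ((r : ℝ) - 1) ^ (2 * (r - 1)) * (D * (1 / 2 : ℝ) ^ D) ≤ 1 := by
      have h1 := (tendsto_self_mul_const_pow_of_lt_one (r := (1 / 2 : ℝ)) (by norm_num)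
        (by norm_num)).const_mul ((r : ℝ) * ((r : ℝ) - 1) ^ (2 * (r - 1)))
      rw [mul_zero] at h1
      exact eventually_atTop.1 (h1.eventually (eventually_le_nhds one_pos))
    refine withHighProb_of_eventually ?_
    -- This threshold bounds the size of a ball of radius `D₀`, so a larger `n` forces the diameter
    -- to be at least `D₀`.
    filter_upwards [(tendsto_natCast_atTop_atTop (R := ℝ)).eventually_gt_atTop
      (1 + ∑ i ∈ Finset.range D₀, (r : ℝ) * ((r : ℝ) - 1) ^ i)] with n hn G hG hP σ hσ
    have hJ : 0 ≤ J n := zero_le_one.trans hP.one_le_J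
    have hr3 : (3 : ℝ) ≤ r := by exact_mod_cast hr
    have hnn : ∀ i, 0 ≤ powInteraction (J n) (lam n) i := fun i => by
      rw [powInteraction]; positivity
    have hdiam : D₀ ≤ G.diam := by
      by_contra hlt
      have := hP.connected.card_le_of_diam_le hG (by omega) (not_le.1 hlt).le
      rw [Fintype.card_fin] at this
      exact this.not_gt hn
    refine stabilityLevel_le_of_sum_le G hnn hP.h_pos
      (B := J n * ((r : ℝ) * fPow r (lam n) G.diam + 1)) (fun x => ?_) hσ
    have h1 := hP.connected.sum_dist_le hG (by omega) hnn x
    have h2 : ∑ i ∈ Finset.range G.diam,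
        (r : ℝ) * ((r : ℝ) - 1) ^ i * powInteraction (J n) (lam n) (i + 1) ≤
        J n * ((r : ℝ) * fPow r (lam n) G.diam + 1) := by
      rw [fPow]
      split_ifs with hd
      · refine (sum_powInteraction_le_of_le (by omega) hJ hd (hD₀ _ hdiam)).trans
          (mul_le_mul_of_nonneg_left ?_ hJ)
        -- Here `r ≥ 3` enters, through `r ≤ r * (r - 2)`.
        nlinarith
      · refine (sum_powInteraction_le_zetaSum (by omega) hJ (by linarith [hlam n]) _).trans
          (mul_le_mul_of_nonneg_left ?_ hJ)
        linarith
    exact h1.trans h2
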